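/- Let $d\ge 0$ be an integer, let $\Omega\subset\mathbb{R}^d$ be a nonempty bounded convex open set and let $V\subset\mathbb{Z}^d$ contain the canonical basis and satisfy $-e\in V$ whenever $e\in V$ (for instance $V=\mathbb{Z}^d$). For $h>0$ put $$\Omega_h=\Omega\cap h\mathbb{Z}^d,\qquad h^e_y=\sup\{rh:\ r\in[0,1],\ y+rhe\in\overline\Omega\}\quad (y\in\Omega_h,\ e\in\mathbb{Z}^d),$$ $$\partial\Omega_h=\{x\in\partial\Omega:\ x=y+h^e_y e\text{ for some }y\in\Omega_h,\ e\in V\},\qquad \mathcal N_h=\Omega_h\cup\partial\Omega_h .$$ A mesh function is a function $u_h:\mathcal N_h\to\mathbb{R}$. For $x\in\Omega_h$ let $$\partial_h u_h(x)=\{p\in\mathbb{R}^d:\ u_h(y)\ge u_h(x)+p\cdot(y-x)\ \ \forall y\in\mathcal N_h\},\qquad \partial_h u_h(E)=\bigcup_{x\in E\cap h\mathbb{Z}^d}\partial_h u_h(x)\quad(E\subset\Omega).$$ Let $u:\overline\Omega\to\mathbb{R}$ be bounded and convex. For $x\in\Omega$ let $\partial u(x)=\{p\in\mathbb{R}^d:\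 u(y)\ge u(x)+p\cdot(y-x)\ \forall y\in\Omega\}$, and let $\partial u(E)=\bigcup_{x\in E}\partial u(x)$ for $E\subset\Omega$. Let $R\ge 0$ be a locally integrable function on $\mathbb{R}^d$ with $R>0$ on $\partial u(\Omega)$, and put $$\omega(R,u,E)=\int_{\partial u(E)}R(p)\,dp,\qquad \omega(R,u_h,E)=\int_{\partial_h u_h(E)}R(p)\,dp .$$ Let $u_h$ be a mesh function for each $h>0$, and assume that $u_h$ converges to $u$ uniformly on $\overline\Omega$: for every sequence $h_k\to0$ of positive numbers and every $\epsilon>0$ there is $h_{-1}>0$ such that $|u_{h_k}(x)-u(x)|<\epsilon$ for all $x\in\mathcal N_{h_k}$ and all $k$ with $h_k<h_{-1}$. Then, for every sequence $h_k\to 0$ of positive numbers, $\omega(R,u_{h_k},\cdot)$ converges weakly to $\omega(R,u,\cdot)$ on $\Omega$, that is, $$\omega(R,u_{h_k},B)\to\omega(R,u,B)$$ for every Borel set $B\subset\Omega$ with $\partial B\subset\Omega$ and $\omega(R,u,\partial B)=0$. If in addition $R=0$ on $\mathbb{R}^d\setminus\partial u(\Omega)$ and $\omega(R,u,\Omega)<\infty$,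 then this convergence holds for every Borel set $B\subset\Omega$ with $\omega(R,u,\partial B\cap\Omega)=0$. -/

import Mathlib

open Set Filter Topology MeasureTheory
open scoped ENNReal

noncomputable section

namespace MeshMA

/-- The space `ℝ^d` with its Euclidean norm. -/
abbrev Space (d : ℕ) := EuclideanSpace ℝ (Fin d)

/-- An integer vector seen as a vector of `ℝ^d`. -/
def intVec {d : ℕ} (e : Fin d → ℤ) : Space d := WithLp.toLp 2 (fun i => (e i : ℝ))

/-- The orthogonal lattice `h ℤ^d` of mesh length `h`. -/
def lattice (d : ℕ) (h : ℝ) : Set (Space d) := {x | ∃ m : Fin d → ℤ, x = h • intVec m}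

/-- The interior nodes `Ω_h`, the lattice points in `Ω`. -/
def interiorNodes {d : ℕ} (Ω : Set (Space d)) (h : ℝ) : Set (Space d) := Ω ∩ lattice d h

/-- The step `h^e_x`, the supremum of the `r h` with `r ∈ [0,1]` and `x + r h e` in the closure
of `Ω`. -/
def stepLength {d : ℕ} (Ω : Set (Space d)) (h : ℝ) (e : Fin d → ℤ) (x : Space d) : ℝ :=
  sSup {s : ℝ | ∃ r ∈ Icc (0 : ℝ) 1, s = r * h ∧ x + (r * h) • intVec e ∈ closure Ω}

/-- The boundary nodes `∂Ω_h` seen from the interior nodes in the directions of `V`. -/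
def boundaryNodes {d : ℕ} (Ω : Set (Space d)) (V : Set (Fin d → ℤ)) (h : ℝ) : Set (Space d) :=
  {x | x ∈ frontier Ω ∧
    ∃ y ∈ interiorNodes Ω h, ∃ e ∈ V, x = y + stepLength Ω h e y • intVec e}

/-- The set of nodes `N_h = Ω_h ∪ ∂Ω_h`. -/
def nodes {d : ℕ} (Ω : Set (Space d)) (V : Set (Fin d → ℤ)) (h : ℝ) : Set (Space d) :=
  interiorNodes Ω h ∪ boundaryNodes Ω V h

/-- Mesh functions, the real functions on the set of nodes. -/
abbrev MeshFunction {d : ℕ} (Ω : Set (Space d)) (V : Set (Fin d → ℤ)) (h : ℝ) : Type :=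
  nodes Ω V h → ℝ

/-- The subdifferential (normal mapping) at `x` of a function `u` on `Ω`. -/
def subdiff {d : ℕ} (Ω : Set (Space d)) (u : Space d → ℝ) (x : Space d) : Set (Space d) :=
  {p | ∀ y ∈ Ω, u x + inner ℝ p (y - x) ≤ u y}

/-- The image `∂u(E)` of a subset `E` of `Ω` by the subdifferential. -/
def subdiffImage {d : ℕ} (Ω : Set (Space d)) (u : Space d → ℝ) (E : Set (Space d)) :
    Set (Space d) :=
  ⋃ x ∈ E, subdiff Ω u x

/-- The `R`-curvature `ω(R,u,E)`, the integral of the nonnegative function `R` over `∂u(E)`. -/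
def curvature {d : ℕ} (Ω : Set (Space d)) (R : Space d → ℝ) (u : Space d → ℝ)
    (E : Set (Space d)) : ℝ≥0∞ :=
  ∫⁻ p in subdiffImage Ω u E, ENNReal.ofReal (R p)

/-- The discrete normal mapping at `x` of a mesh function `v`. -/
def discreteSubdiff {d : ℕ} {Ω : Set (Space d)} {V : Set (Fin d → ℤ)} {h : ℝ}
    (v : MeshFunction Ω V h) (x : nodes Ω V h) : Set (Space d) :=
  {p | ∀ y : nodes Ω V h, v x + inner ℝ p ((y : Space d) - (x : Space d)) ≤ v y}

/-- The image of a subset `E` of `Ω` by the discrete normal mapping: the union of its values at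
the interior nodes that belong to `E`. -/
def discreteSubdiffImage {d : ℕ} {Ω : Set (Space d)} {V : Set (Fin d → ℤ)} {h : ℝ}
    (v : MeshFunction Ω V h) (E : Set (Space d)) : Set (Space d) :=
  {p | ∃ x : nodes Ω V h, (x : Space d) ∈ E ∧ (x : Space d) ∈ interiorNodes Ω h ∧
    p ∈ discreteSubdiff v x}

/-- The discrete `R`-curvature `ω(R,v,E)` of a mesh function `v`. -/
def discreteCurvature {d : ℕ} {Ω : Set (Space d)} {V : Set (Fin d → ℤ)} {h : ℝ}
    (R : Space d → ℝ) (v : MeshFunction Ω V h) (E : Set (Space d)) : ℝ≥0∞ :=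
  ∫⁻ p in discreteSubdiffImage v E, ENNReal.ofReal (R p)

/-- Uniform convergence of mesh functions `v h`, as `h → 0`, to a function `u` on the closure
of `Ω`. -/
def MeshConvergesUniformly {d : ℕ} {Ω : Set (Space d)} {V : Set (Fin d → ℤ)}
    (v : ∀ h : ℝ, MeshFunction Ω V h) (u : Space d → ℝ) : Prop :=
  ∀ h : ℕ → ℝ, (∀ k, 0 < h k) → Tendsto h atTop (𝓝 0) →
    ∀ ε > 0, ∃ h₀ > 0, ∀ k, h k < h₀ → ∀ x : nodes Ω V (h k), |v (h k) x - u x| < ε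

/-- Weak convergence of set functions on the Borel subsets of `Ω`: convergence on every Borel set
whose boundary lies in `Ω` and is null for the limit. -/
def WeaklyConverges {d : ℕ} (Ω : Set (Space d)) (μ : ℕ → Set (Space d) → ℝ≥0∞)
    (ν : Set (Space d) → ℝ≥0∞) : Prop :=
  ∀ B : Set (Space d), MeasurableSet B → B ⊆ Ω → frontier B ⊆ Ω → ν (frontier B) = 0 →
    Tendsto (fun k => μ k B) atTop (𝓝 (ν B))

/-- The same for all Borel subsets of `Ω`, also those whose closure meets the boundary of `Ω`; only
the part of the boundary of `B` that lies in `Ω` has to be null for the limit. -/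
def WeaklyConvergesUpToBoundary {d : ℕ} (Ω : Set (Space d)) (μ : ℕ → Set (Space d) → ℝ≥0∞)
    (ν : Set (Space d) → ℝ≥0∞) : Prop :=
  ∀ B : Set (Space d), MeasurableSet B → B ⊆ Ω → ν (frontier B ∩ Ω) = 0 →
    Tendsto (fun k => μ k B) atTop (𝓝 (ν B))

end MeshMA

end

/-! Both curvatures are values of one measure, with density `R`, on sets of subgradients, so the
claim is a statement about which `p` belong to these sets, followed by Fatou's lemma and its
reverse. Almost every `p` is a subgradient of `u` at no more than one point of `Ω`
(`ae_subdiff_unique`). If it is one at `x₀` only, then `u` minus its supporting affine function is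
bounded below by a positive constant away from `x₀`; uniform convergence then forces the discrete
contact nodes of `p` to exist near `x₀` and nowhere else (`eventually_discreteSubdiff_near`). This
gives the liminf bound. For the limsup on a compact `K ⊆ Ω`, the discrete subgradients stay in a
fixed ball and limits of contact nodes are contact points. Up to the boundary, finite total mass
replaces the ball, and localization near `x₀` replaces compactness. -/

namespace MeshMA

/-! ### Fatou's lemma and its reverse for sets -/

section MeasureLimits

variable {α : Type*} [MeasurableSpace α] {μ : Measure α}

/-- Continuity from below for the sets `⋂ k ≥ n, A k`; neither `S` nor the `A k` need be measurable.
-/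
theorem measure_le_liminf_of_ae_eventually_mem {A : ℕ → Set α} {S : Set α}
    (hS : ∀ᵐ p ∂μ, p ∈ S → ∀ᶠ k in atTop, p ∈ A k) :
    μ S ≤ liminf (fun k => μ (A k)) atTop := by
  have hmono : Monotone fun n => ⋂ k ≥ n, A k := fun m n hmn =>
    biInter_subset_biInter_left fun k (hk : n ≤ k) => hmn.trans hk
  have hle : μ S ≤ μ (⋃ n, ⋂ k ≥ n, A k) := by
    refine measure_mono_ae ?_
    filter_upwards [hS] with p hp hpS
    obtain ⟨n, hn⟩ := eventually_atTop.1 (hp hpS)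
    exact mem_iUnion.2 ⟨n, mem_iInter₂.2 hn⟩
  refine hle.trans ?_
  rw [hmono.measure_iUnion, liminf_eq_iSup_iInf_of_nat]
  exact iSup_mono fun n => le_iInf₂ fun k hk => measure_mono (biInter_subset_of_mem hk)

/-- Continuity from above for the tails `⋃ k ≥ n, A k`, which needs the finite bound provided by
`T`. -/
theorem limsup_measure_le_of_ae_frequently_mem {A : ℕ → Set α} {S T : Set α}
    (hA : ∀ k, MeasurableSet (A k)) (hT : μ T ≠ ⊤) (hAT : ∀ᶠ k in atTop, A k ⊆ T)
    (hS : ∀ᵐ p ∂μ, (∃ᶠ k in atTop, p ∈ A k) → p ∈ S) :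
    limsup (fun k => μ (A k)) atTop ≤ μ S := by
  obtain ⟨N, hN⟩ := eventually_atTop.1 hAT
  have hanti : Antitone fun n => ⋃ k ≥ n, A k := fun m n hmn =>
    biUnion_subset_biUnion_left fun k (hk : n ≤ k) => hmn.trans hk
  have hlim := tendsto_measure_iInter_atTop (μ := μ) (s := fun n => ⋃ k ≥ n, A k)
    (fun n => (MeasurableSet.iUnion fun k => .iUnion fun _ => hA k).nullMeasurableSet) hanti
    ⟨N, ((measure_mono (iUnion₂_subset hN)).trans_lt hT.lt_top).ne⟩
  have hle : μ (⋂ n, ⋃ k ≥ n, A k) ≤ μ S := by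
    refine measure_mono_ae ?_
    filter_upwards [hS] with p hp hpA
    refine hp (frequently_atTop.2 fun n => ?_)
    simpa using mem_iInter.1 hpA n
  refine le_trans ?_ hle
  rw [← hlim.limsup_eq]
  refine limsup_le_limsup (Eventually.of_forall fun k => ?_)
  exact measure_mono (subset_biUnion_of_mem (u := A) (le_refl k))

end MeasureLimits

variable {d : ℕ}

/-! ### Density and local finiteness of the lattice -/

section Lattice

/-- Rounding each coordinate down costs at most `h` per coordinate; the cruder `d` replaces `√d`. -/
theorem exists_lattice_norm_sub_le {h : ℝ} (hh : 0 < h) (y : Space d) :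
    ∃ z ∈ lattice d h, ‖z - y‖ ≤ d * h := by
  refine ⟨h • intVec fun i => ⌊y i / h⌋, ⟨_, rfl⟩, ?_⟩
  rw [EuclideanSpace.norm_eq]
  refine Real.sqrt_le_iff.2 ⟨by positivity, ?_⟩
  have hi : ∀ i : Fin d, ‖(h • intVec (fun i => ⌊y i / h⌋) - y) i‖ ^ 2 ≤ h ^ 2 := by
    intro i
    have h1 : h * ⌊y i / h⌋ ≤ y i := by
      have := mul_le_mul_of_nonneg_left (Int.floor_le (y i / h)) hh.le
      rwa [mul_div_cancel₀ _ hh.ne'] at this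
    have h2 : y i ≤ h * ⌊y i / h⌋ + h := by
      have := mul_le_mul_of_nonneg_left (Int.lt_floor_add_one (y i / h)).le hh.le
      rw [mul_div_cancel₀ _ hh.ne'] at this
      linarith
    refine pow_le_pow_left₀ (norm_nonneg _) ?_ 2
    simp only [PiLp.sub_apply, PiLp.smul_apply, intVec, smul_eq_mul, Real.norm_eq_abs]
    rw [abs_le]
    constructor <;> linarith
  calc _ ≤ ∑ _i : Fin d, h ^ 2 := Finset.sum_le_sum fun i _ => hi i
    _ = d * h ^ 2 := by simp
    _ ≤ (d * h) ^ 2 := by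
      rw [mul_pow]
      have : (d : ℝ) ≤ (d : ℝ) ^ 2 := by exact_mod_cast Nat.le_self_pow two_ne_zero d
      gcongr

theorem lattice_countable (d : ℕ) (h : ℝ) : (lattice d h).Countable :=
  (countable_range fun m : Fin d → ℤ => h • intVec m).mono <| by
    rintro _ ⟨m, rfl⟩
    exact ⟨m, rfl⟩

theorem lattice_inter_finite {h : ℝ} (hh : 0 < h) {s : Set (Space d)}
    (hs : Bornology.IsBounded s) : (s ∩ lattice d h).Finite := by
  obtain ⟨C, hC⟩ := hs.exists_norm_le
  have hfin : (Set.Icc (fun _ : Fin d => -⌈C / h⌉) (fun _ => ⌈C / h⌉)).Finite := finite_Icc _ _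
  refine (hfin.image fun m => h • intVec m).subset ?_
  rintro _ ⟨hxs, m, rfl⟩
  refine ⟨m, ?_, rfl⟩
  have hm : ∀ i, |(m i : ℝ)| ≤ ⌈C / h⌉ := fun i => by
    have h1 := (PiLp.norm_apply_le (h • intVec m) i).trans (hC _ hxs)
    simp only [PiLp.smul_apply, intVec, smul_eq_mul, norm_mul, Real.norm_eq_abs,
      abs_of_pos hh] at h1
    refine le_trans ?_ (Int.le_ceil _)
    rw [le_div_iff₀ hh]
    linarith
  refine ⟨fun i => ?_, fun i => ?_⟩
  · have := (abs_le.1 (hm i)).1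
    exact_mod_cast this
  · have := (abs_le.1 (hm i)).2
    exact_mod_cast this

end Lattice

/-! ### Almost every slope has at most one contact point -/

section UniqueContact

variable {Ω : Set (Space d)} {u : Space d → ℝ}

/-- The Legendre transform of `u` on `Ω`. -/
noncomputable def legendre (Ω : Set (Space d)) (u : Space d → ℝ) (p : Space d) : ℝ :=
  ⨆ x : Ω, (inner ℝ p (x : Space d) - u x)

theorem bddAbove_legendre (hΩ : Bornology.IsBounded Ω) (hu : ∃ M, ∀ x ∈ Ω, |u x| ≤ M)
    (p : Space d) : BddAbove (range fun x : Ω => inner ℝ p (x : Space d) - u x) := by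
  obtain ⟨C, hC⟩ := hΩ.exists_norm_le
  obtain ⟨M, hM⟩ := hu
  refine ⟨‖p‖ * C + M, ?_⟩
  rintro _ ⟨x, rfl⟩
  have h1 := (real_inner_le_norm p (x : Space d)).trans
    (mul_le_mul_of_nonneg_left (hC x x.2) (norm_nonneg p))
  have h2 := (abs_le.1 (hM x x.2)).1
  dsimp only
  linarith

theorem lipschitzWith_legendre (hne : Ω.Nonempty) (hΩ : Bornology.IsBounded Ω)
    (hu : ∃ M, ∀ x ∈ Ω, |u x| ≤ M) : ∃ K, LipschitzWith K (legendre Ω u) := by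
  obtain ⟨C, hC⟩ := hΩ.exists_norm_le
  have : Nonempty Ω := hne.to_subtype
  refine ⟨_, LipschitzWith.of_le_add_mul' C fun p q => ciSup_le fun x => ?_⟩
  have h1 := le_ciSup (bddAbove_legendre hΩ hu q) x
  have h2 := (real_inner_le_norm (p - q) (x : Space d)).trans
    (mul_le_mul_of_nonneg_left (hC x x.2) (norm_nonneg _))
  rw [inner_sub_left] at h2
  rw [dist_eq_norm]
  change _ ≤ legendre Ω u q at h1
  linarith

/-- The transform dominates `q ↦ ⟪q, x⟫ - u x`, with equality at `p`; hence the difference is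
minimal there and its derivative vanishes. -/
theorem fderiv_legendre (hΩ : Bornology.IsBounded Ω) (hu : ∃ M, ∀ x ∈ Ω, |u x| ≤ M)
    {p x : Space d} (hp : DifferentiableAt ℝ (legendre Ω u) p) (hx : x ∈ Ω)
    (hpx : p ∈ subdiff Ω u x) : fderiv ℝ (legendre Ω u) p = innerSL ℝ x := by
  have : Nonempty Ω := ⟨⟨x, hx⟩⟩
  have hmin : IsLocalMin (fun q => legendre Ω u q - innerSL ℝ x q) p := by
    refine Eventually.of_forall fun q => ?_
    have h1 : inner ℝ q x - u x ≤ legendre Ω u q := le_ciSup (bddAbove_legendre hΩ hu q) ⟨x, hx⟩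
    have h2 : legendre Ω u p ≤ inner ℝ p x - u x := ciSup_le fun y => by
      have := hpx y y.2
      rw [inner_sub_right] at this
      linarith
    simp only [innerSL_apply_apply, real_inner_comm _ x]
    linarith
  have h0 := hmin.fderiv_eq_zero
  rw [fderiv_fun_sub hp (innerSL ℝ x).differentiableAt, ContinuousLinearMap.fderiv] at h0
  exact sub_eq_zero.1 h0

/-- By Rademacher the Lipschitz transform is differentiable almost everywhere, and its gradient
determines the contact point. -/
theorem ae_subdiff_unique (hne : Ω.Nonempty) (hΩ : Bornology.IsBounded Ω)
    (hu : ∃ M, ∀ x ∈ Ω, |u x| ≤ M) :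
    ∀ᵐ p : Space d, ∀ x ∈ Ω, p ∈ subdiff Ω u x → ∀ y ∈ Ω, p ∈ subdiff Ω u y → y = x := by
  obtain ⟨K, hK⟩ := lipschitzWith_legendre hne hΩ hu
  filter_upwards [hK.ae_differentiableAt] with p hp x hx hpx y hy hpy
  have := (fderiv_legendre hΩ hu hp hy hpy).symm.trans (fderiv_legendre hΩ hu hp hx hpx)
  refine ext_inner_right ℝ fun z => ?_
  simpa using congrArg (fun L => L z) this

end UniqueContact

/-! ### Quantitative separation from the supporting plane -/

section Contact

variable {Ω : Set (Space d)} {u : Space d → ℝ}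

/-- Compactness gives `m` on the sphere; convexity along segments from `x₀` carries it outward, up
to boundary points where `u` may be discontinuous. -/
theorem exists_pos_le_sub_affine (hΩ_open : IsOpen Ω) (hu_conv : ConvexOn ℝ (closure Ω) u)
    {p x₀ : Space d} (hx₀ : x₀ ∈ Ω) (hp : p ∈ subdiff Ω u x₀)
    (huniq : ∀ y ∈ Ω, p ∈ subdiff Ω u y → y = x₀) {δ : ℝ} (hδ : 0 < δ)
    (hball : Metric.closedBall x₀ δ ⊆ Ω) :
    ∃ m > 0, ∀ y ∈ closure Ω, δ ≤ ‖y - x₀‖ → m ≤ u y - u x₀ - inner ℝ p (y - x₀) := by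
  have hcont : ContinuousOn u Ω :=
    hu_conv.continuousOn_interior.mono (interior_maximal subset_closure hΩ_open)
  have hpos : ∀ y ∈ Metric.sphere x₀ δ, 0 < u y - u x₀ - inner ℝ p (y - x₀) := by
    intro y hy
    have hyΩ := hball (Metric.sphere_subset_closedBall hy)
    by_contra hle
    have hyx : y = x₀ := huniq y hyΩ fun z hz => by
      have h1 := hp z hz
      have h2 : inner ℝ p (z - x₀) = inner ℝ p (z - y) + inner ℝ p (y - x₀) := by
        rw [← inner_add_right, sub_add_sub_cancel]
      linarith
    rw [hyx, Metric.mem_sphere, dist_self] at hy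
    exact hδ.ne hy
  have hwcont : ContinuousOn (fun y => u y - u x₀ - inner ℝ p (y - x₀))
      (Metric.sphere x₀ δ) :=
    ((hcont.mono (Metric.sphere_subset_closedBall.trans hball)).sub continuousOn_const).sub
      (by fun_prop)
  obtain ⟨m, hm, hmle⟩ := (isCompact_sphere x₀ δ).exists_forall_le' hwcont hpos
  refine ⟨m, hm, fun y hy hyδ => ?_⟩
  have hn : 0 < ‖y - x₀‖ := hδ.trans_le hyδ
  have ht0 : 0 < δ / ‖y - x₀‖ := div_pos hδ hn
  have ht1 : δ / ‖y - x₀‖ ≤ 1 := (div_le_one hn).2 hyδ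
  set t := δ / ‖y - x₀‖ with ht
  have hz : x₀ + t • (y - x₀) ∈ Metric.sphere x₀ δ := by
    rw [mem_sphere_iff_norm, add_sub_cancel_left, norm_smul, Real.norm_eq_abs, abs_of_pos ht0, ht,
      div_mul_cancel₀ _ hn.ne']
  have h1 := hmle _ hz
  have h2 := hu_conv.2 (subset_closure hx₀) hy (sub_nonneg.2 ht1) ht0.le (sub_add_cancel 1 t)
  have h3 : (1 - t) • x₀ + t • y = x₀ + t • (y - x₀) := by module
  rw [h3] at h2
  simp only [smul_eq_mul] at h2
  rw [add_sub_cancel_left, inner_smul_right] at h1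
  have h4 : m ≤ t * (u y - u x₀ - inner ℝ p (y - x₀)) := by linarith
  have h5 : 0 < u y - u x₀ - inner ℝ p (y - x₀) := by
    by_contra hneg
    have := mul_nonpos_of_nonneg_of_nonpos ht0.le (not_lt.1 hneg)
    linarith
  exact h4.trans (mul_le_of_le_one_left h5.le ht1)

end Contact

/-! ### Asymptotics of discrete subgradients -/

section MeshLimits

variable {Ω : Set (Space d)} {V : Set (Fin d → ℤ)} {u : Space d → ℝ}
  {v : ∀ h : ℝ, MeshFunction Ω V h} {h : ℕ → ℝ}

theorem nodes_subset_closure {t : ℝ} : nodes Ω V t ⊆ closure Ω :=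
  union_subset (inter_subset_left.trans subset_closure)
    fun _ hx => frontier_subset_closure hx.1

theorem MeshConvergesUniformly.eventually (hv : MeshConvergesUniformly v u)
    (h_pos : ∀ k, 0 < h k) (h_lim : Tendsto h atTop (𝓝 0)) {ε : ℝ} (hε : 0 < ε) :
    ∀ᶠ k in atTop, ∀ x : nodes Ω V (h k), |v (h k) x - u x| < ε := by
  obtain ⟨h₀, hh₀, H⟩ := hv h h_pos h_lim ε hε
  filter_upwards [h_lim.eventually (gt_mem_nhds hh₀)] with k hk using H k hk

theorem eventually_mul_lt (h_lim : Tendsto h atTop (𝓝 0)) {ρ : ℝ} (hρ : 0 < ρ) :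
    ∀ᶠ k in atTop, d * h k < ρ := by
  have : Tendsto (fun k => d * h k) atTop (𝓝 0) := by simpa using h_lim.const_mul (d : ℝ)
  exact this.eventually (gt_mem_nhds hρ)

theorem measurableSet_discreteSubdiffImage {t : ℝ} (w : MeshFunction Ω V t) (E : Set (Space d)) :
    MeasurableSet (discreteSubdiffImage w E) := by
  have heq : discreteSubdiffImage w E =
      ⋃ x ∈ {x : nodes Ω V t | (x : Space d) ∈ E ∧ (x : Space d) ∈ interiorNodes Ω t},
        discreteSubdiff w x := by
    ext p
    simp only [discreteSubdiffImage, mem_ofPred_eq, mem_iUnion, exists_prop, and_assoc]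
  rw [heq]
  refine MeasurableSet.biUnion ?_ fun x _ => ?_
  · refine MapsTo.countable_of_injOn (t := lattice d t) (f := Subtype.val) (fun x hx => hx.2.2)
      Subtype.val_injective.injOn (lattice_countable d t)
  · have : discreteSubdiff w x =
        ⋂ y : nodes Ω V t, {p | w x + inner ℝ p ((y : Space d) - (x : Space d)) ≤ w y} := by
      ext p
      simp [discreteSubdiff]
    rw [this]
    exact (isClosed_iInter fun y => isClosed_le (by fun_prop) continuous_const).measurableSet

theorem discreteSubdiffImage_mono {t : ℝ} (w : MeshFunction Ω V t) {E F : Set (Space d)}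
    (hEF : E ⊆ F) : discreteSubdiffImage w E ⊆ discreteSubdiffImage w F :=
  fun _ ⟨x, hx, hx'⟩ => ⟨x, hEF hx, hx'⟩

/-- If `x₀` is the only point of `Ω` where `p` is a subgradient of `u`, then `p` is eventually a
discrete subgradient near `x₀` and only there. -/
theorem eventually_discreteSubdiff_near (hΩ_open : IsOpen Ω) (hu_conv : ConvexOn ℝ (closure Ω) u)
    (hv : MeshConvergesUniformly v u) (h_pos : ∀ k, 0 < h k) (h_lim : Tendsto h atTop (𝓝 0))
    {p x₀ : Space d} (hx₀ : x₀ ∈ Ω) (hp : p ∈ subdiff Ω u x₀)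
    (huniq : ∀ y ∈ Ω, p ∈ subdiff Ω u y → y = x₀) {r : ℝ} (hr : 0 < r) :
    ∀ᶠ k in atTop, (∀ x : nodes Ω V (h k), p ∈ discreteSubdiff (v (h k)) x →
        (x : Space d) ∈ Metric.ball x₀ r) ∧
      p ∈ discreteSubdiffImage (v (h k)) (Metric.ball x₀ r) := by
  obtain ⟨δ₀, hδ₀, hball₀⟩ := Metric.nhds_basis_closedBall.mem_iff.1 (hΩ_open.mem_nhds hx₀)
  set δ := min δ₀ r with hδdef
  have hδ : 0 < δ := lt_min hδ₀ hr
  have hball : Metric.closedBall x₀ δ ⊆ Ω :=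
    (Metric.closedBall_subset_closedBall (min_le_left _ _)).trans hball₀
  obtain ⟨m, hm, hmle⟩ :=
    exists_pos_le_sub_affine hΩ_open hu_conv hx₀ hp huniq hδ hball
  have hcont : ContinuousAt (fun y => u y - u x₀ - inner ℝ p (y - x₀)) x₀ := by
    have : ContinuousAt u x₀ := (hu_conv.continuousOn_interior.mono
      (interior_maximal subset_closure hΩ_open)).continuousAt (hΩ_open.mem_nhds hx₀)
    fun_prop
  -- With mesh error `m / 3`, a node near `x₀` stays below `2m/3`, while nodes outside the ball stay
  -- above it.
  have hnear : ∀ᶠ y in 𝓝 x₀, u y - u x₀ - inner ℝ p (y - x₀) < m / 3 :=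
    hcont.eventually (gt_mem_nhds (by simpa using by positivity))
  obtain ⟨ρ, hρ, hρlt⟩ := Metric.eventually_nhds_iff.1 hnear
  filter_upwards [eventually_mul_lt (d := d) h_lim (lt_min hρ hδ),
    hv.eventually h_pos h_lim (show 0 < m / 3 by positivity)] with k hk hvk
  obtain ⟨z, hzl, hz⟩ := exists_lattice_norm_sub_le (h_pos k) x₀
  rw [← dist_eq_norm] at hz
  have hzb : z ∈ Metric.ball x₀ δ := hz.trans_lt (hk.trans_le (min_le_right _ _))
  have hzN : z ∈ nodes Ω V (h k) := Or.inl ⟨hball (Metric.ball_subset_closedBall hzb), hzl⟩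
  have hzu := hρlt (hz.trans_lt (hk.trans_le (min_le_left _ _)))
  have hzv := (abs_lt.1 (hvk ⟨z, hzN⟩)).2
  have hfar : ∀ y : nodes Ω V (h k), (y : Space d) ∉ Metric.ball x₀ δ →
      v (h k) ⟨z, hzN⟩ - inner ℝ p (z - x₀) < v (h k) y - inner ℝ p ((y : Space d) - x₀) := by
    intro y hy
    have h1 := hmle y (nodes_subset_closure y.2)
      (by rw [← dist_eq_norm]; exact not_lt.1 hy)
    have h2 := (abs_lt.1 (hvk y)).1
    dsimp only at hzv
    linarith
  have hadd : ∀ x y : Space d, inner ℝ p (y - x₀) = inner ℝ p (y - x) + inner ℝ p (x - x₀) :=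
    fun x y => by rw [← inner_add_right, sub_add_sub_cancel]
  have hδr : Metric.ball x₀ δ ⊆ Metric.ball x₀ r := Metric.ball_subset_ball (min_le_right _ _)
  refine ⟨fun x hpx => ?_, ?_⟩
  · by_contra hx
    have h1 := hfar x fun hx' => hx (hδr hx')
    have h2 := hpx ⟨z, hzN⟩
    have h3 := hadd x z
    dsimp only at h2
    linarith
  -- A minimizer over the finite set `S` is global, because `z ∈ S` already beats every node
  -- outside.
  · set S : Set (nodes Ω V (h k)) := {x | (x : Space d) ∈ Metric.ball x₀ δ} with hS
    have hSint : ∀ x ∈ S, (x : Space d) ∈ interiorNodes Ω (h k) := fun x hx =>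
      x.2.resolve_right fun hb =>
        (hΩ_open.frontier_eq ▸ hb.1 : (x : Space d) ∈ closure Ω \ Ω).2
          (hball (Metric.ball_subset_closedBall hx))
    have hSfin : S.Finite :=
      Finite.of_finite_image ((lattice_inter_finite (h_pos k) Metric.isBounded_ball).subset (by
        rintro _ ⟨x, hx, rfl⟩
        exact ⟨hx, (hSint x hx).2⟩)) Subtype.val_injective.injOn
    obtain ⟨x, hxS, hxmin⟩ := hSfin.exists_minimalFor
      (fun y => v (h k) y - inner ℝ p ((y : Space d) - x₀)) S ⟨⟨z, hzN⟩, hzb⟩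
    have hxle : ∀ y ∈ S, v (h k) x - inner ℝ p ((x : Space d) - x₀) ≤
        v (h k) y - inner ℝ p ((y : Space d) - x₀) := fun y hy => by
      by_contra hlt
      exact hlt (hxmin hy (not_le.1 hlt).le)
    refine ⟨x, hδr hxS, hSint x hxS, fun y => ?_⟩
    have h3 := hadd x y
    by_cases hy : y ∈ S
    · have := hxle y hy
      linarith
    · have h1 := hfar y hy
      have h2 := hxle ⟨z, hzN⟩ hzb
      dsimp only at h2
      linarith

/-- Moving from `x` by `δ / 2` along `p` and rounding to a node still gains at least `‖p‖ * δ / 4`,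
whereas the mesh values differ by at most `2 * M + 2`. -/
theorem eventually_discreteSubdiffImage_subset_closedBall (hΩ_open : IsOpen Ω)
    (hu_bdd : ∃ M, ∀ x ∈ closure Ω, |u x| ≤ M) (hv : MeshConvergesUniformly v u)
    (h_pos : ∀ k, 0 < h k) (h_lim : Tendsto h atTop (𝓝 0)) {K : Set (Space d)}
    (hK : IsCompact K) (hKΩ : K ⊆ Ω) :
    ∃ r, ∀ᶠ k in atTop, discreteSubdiffImage (v (h k)) K ⊆ Metric.closedBall 0 r := by
  obtain ⟨M, hM⟩ := hu_bdd
  obtain ⟨δ, hδ, hδΩ⟩ := hK.exists_cthickening_subset_open hΩ_open hKΩ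
  refine ⟨(2 * M + 2) / (δ / 4), ?_⟩
  filter_upwards [eventually_mul_lt (d := d) h_lim (show 0 < δ / 4 by positivity),
    hv.eventually h_pos h_lim one_pos] with k hk hvk
  rintro p ⟨x, hxK, -, hpx⟩
  rw [mem_closedBall_zero_iff, le_div_iff₀ (by positivity)]
  rcases eq_or_ne p 0 with rfl | hp
  · have hMx := (abs_nonneg _).trans (hM x (subset_closure (hKΩ hxK)))
    simp only [norm_zero, zero_mul]
    linarith
  have hpn : 0 < ‖p‖ := norm_pos_iff.2 hp
  set y : Space d := x + (δ / 2 / ‖p‖) • p with hy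
  obtain ⟨z, hzl, hz⟩ := exists_lattice_norm_sub_le (h_pos k) y
  have hyx : ‖y - x‖ = δ / 2 := by
    rw [hy, add_sub_cancel_left, norm_smul, Real.norm_eq_abs, abs_of_pos (by positivity),
      div_mul_cancel₀ _ hpn.ne']
  have hzx : dist z x ≤ δ := by
    rw [dist_eq_norm, ← sub_add_sub_cancel z y (x : Space d)]
    refine (norm_add_le _ _).trans ?_
    linarith
  have hzΩ : z ∈ Ω := hδΩ (Metric.mem_cthickening_of_dist_le z x δ K hxK hzx)
  have hzN : z ∈ nodes Ω V (h k) := Or.inl ⟨hzΩ, hzl⟩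
  have h1 := hpx ⟨z, hzN⟩
  have h2 : inner ℝ p (z - (x : Space d)) = inner ℝ p (z - y) + inner ℝ p (y - x) := by
    rw [← inner_add_right, sub_add_sub_cancel]
  have h3 : inner ℝ p (y - (x : Space d)) = δ / 2 * ‖p‖ := by
    rw [hy, add_sub_cancel_left, inner_smul_right, real_inner_self_eq_norm_sq]
    field_simp
  have h4 : -(‖p‖ * (δ / 4)) ≤ inner ℝ p (z - y) := by
    have := (abs_le.1 (abs_real_inner_le_norm p (z - y))).1
    have := mul_le_mul_of_nonneg_left (hz.trans hk.le) hpn.le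
    linarith
  have h5 := abs_lt.1 (hvk ⟨z, hzN⟩)
  have h6 := abs_lt.1 (hvk x)
  have h7 := abs_le.1 (hM z (subset_closure hzΩ))
  have h8 := abs_le.1 (hM x (subset_closure (hKΩ hxK)))
  dsimp only at h1 h5
  linarith [h5.1, h5.2, h6.1, h6.2, h7.1, h7.2, h8.1, h8.2]

/-- Contact nodes subconverge in `K`, and testing against lattice points tending to `y` passes to
the limit, since `u` is continuous in `Ω`. -/
theorem mem_subdiffImage_of_frequently (hΩ_open : IsOpen Ω)
    (hu_conv : ConvexOn ℝ (closure Ω) u) (hv : MeshConvergesUniformly v u)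
    (h_pos : ∀ k, 0 < h k) (h_lim : Tendsto h atTop (𝓝 0)) {K : Set (Space d)}
    (hK : IsCompact K) (hKΩ : K ⊆ Ω) {p : Space d}
    (hp : ∃ᶠ k in atTop, p ∈ discreteSubdiffImage (v (h k)) K) : p ∈ subdiffImage Ω u K := by
  have hcont : ∀ x ∈ Ω, ContinuousAt u x := fun x hx => (hu_conv.continuousOn_interior.mono
    (interior_maximal subset_closure hΩ_open)).continuousAt (hΩ_open.mem_nhds hx)
  obtain ⟨φ, hφ, hpφ⟩ := extraction_of_frequently_atTop hp
  choose x hxK hxint hpx using hpφ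
  obtain ⟨a, haK, ψ, hψ, hlim⟩ := hK.tendsto_subseq hxK
  refine mem_iUnion₂.2 ⟨a, haK, fun y hy => ?_⟩
  choose z hzl hz using fun k => exists_lattice_norm_sub_le (h_pos k) y
  have hzy : Tendsto z atTop (𝓝 y) := by
    rw [tendsto_iff_norm_sub_tendsto_zero]
    refine squeeze_zero (fun _ => norm_nonneg _) hz ?_
    simpa using h_lim.const_mul (d : ℝ)
  have hθ : Tendsto (fun n => φ (ψ n)) atTop atTop := (hφ.comp hψ).tendsto_atTop
  have hzθ := hzy.comp hθ
  have hleft : Tendsto (fun n => u (x (ψ n)) + inner ℝ p (z (φ (ψ n)) - (x (ψ n) : Space d)))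
      atTop (𝓝 (u a + inner ℝ p (y - a))) :=
    ((hcont a (hKΩ haK)).tendsto.comp hlim).add (tendsto_const_nhds.inner (hzθ.sub hlim))
  have hright : Tendsto (fun n => u (z (φ (ψ n)))) atTop (𝓝 (u y)) :=
    (hcont y hy).tendsto.comp hzθ
  refine le_of_forall_pos_le_add fun ε hε => ?_
  refine le_of_tendsto_of_tendsto hleft (hright.add_const ε) ?_
  filter_upwards [hθ.eventually (hv.eventually h_pos h_lim (half_pos hε)),
    hzθ.eventually (hΩ_open.mem_nhds hy)] with n hn hzn
  have h1 := hpx (ψ n) ⟨z (φ (ψ n)), Or.inl ⟨hzn, hzl _⟩⟩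
  have h2 := (abs_lt.1 (hn ⟨z (φ (ψ n)), Or.inl ⟨hzn, hzl _⟩⟩)).2
  have h3 := (abs_lt.1 (hn (x (ψ n)))).1
  dsimp only at h1 h2
  linarith

end MeshLimits

/-! ### Liminf and limsup bounds for the curvatures -/

section Curvature

variable {Ω : Set (Space d)} {V : Set (Fin d → ℤ)} {R u : Space d → ℝ}

/-- The measure on `ℝ^d` with density `R`. -/
noncomputable def densityMeasure (R : Space d → ℝ) : Measure (Space d) :=
  volume.withDensity fun p => ENNReal.ofReal (R p)

theorem curvature_eq (E : Set (Space d)) :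
    curvature Ω R u E = densityMeasure R (subdiffImage Ω u E) :=
  (withDensity_apply' _ _).symm

theorem discreteCurvature_eq {t : ℝ} (w : MeshFunction Ω V t) (E : Set (Space d)) :
    discreteCurvature R w E = densityMeasure R (discreteSubdiffImage w E) :=
  (withDensity_apply' _ _).symm

theorem densityMeasure_isCompact_ne_top (hR : LocallyIntegrable R) {K : Set (Space d)}
    (hK : IsCompact K) : densityMeasure R K ≠ ⊤ := by
  rw [densityMeasure, withDensity_apply']
  exact (hR.integrableOn_isCompact hK).lintegral_lt_top.ne

theorem densityMeasure_compl_eq_zero {S : Set (Space d)} (hR : LocallyIntegrable R)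
    (hS : ∀ p, p ∉ S → R p = 0) : densityMeasure R Sᶜ = 0 := by
  rw [densityMeasure,
    withDensity_apply_eq_zero' hR.aestronglyMeasurable.aemeasurable.ennreal_ofReal]
  convert measure_empty (μ := (volume : Measure (Space d)))
  refine eq_empty_of_forall_notMem fun p hp => hp.1 ?_
  simp only [hS p hp.2, ENNReal.ofReal_zero]

theorem curvature_mono {E F : Set (Space d)} (hEF : E ⊆ F) :
    curvature Ω R u E ≤ curvature Ω R u F := by
  rw [curvature_eq, curvature_eq]
  exact measure_mono (biUnion_subset_biUnion_left hEF)

theorem curvature_union_le (E F : Set (Space d)) :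
    curvature Ω R u (E ∪ F) ≤ curvature Ω R u E + curvature Ω R u F := by
  simp only [curvature_eq]
  refine (measure_mono ?_).trans (measure_union_le _ _)
  rw [subdiffImage, biUnion_union]
  rfl

theorem curvature_le_of_subset_union {E F N : Set (Space d)} (hE : E ⊆ F ∪ N)
    (hN : curvature Ω R u N = 0) : curvature Ω R u E ≤ curvature Ω R u F := by
  refine ((curvature_mono hE).trans (curvature_union_le F N)).trans ?_
  rw [hN, add_zero]

variable {v : ∀ h : ℝ, MeshFunction Ω V h} {h : ℕ → ℝ}

theorem ae_densityMeasure_subdiff_unique (hne : Ω.Nonempty) (hΩ : Bornology.IsBounded Ω)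
    (hu : ∃ M, ∀ x ∈ closure Ω, |u x| ≤ M) :
    ∀ᵐ p ∂densityMeasure R,
      ∀ x ∈ Ω, p ∈ subdiff Ω u x → ∀ y ∈ Ω, p ∈ subdiff Ω u y → y = x :=
  (withDensity_absolutelyContinuous _ _).ae_le <| ae_subdiff_unique hne hΩ <|
    hu.imp fun _ hM x hx => hM x (subset_closure hx)

theorem curvature_le_liminf_discreteCurvature (hΩ_ne : Ω.Nonempty) (hΩ_open : IsOpen Ω)
    (hΩ_bdd : Bornology.IsBounded Ω) (hu_conv : ConvexOn ℝ (closure Ω) u)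
    (hu_bdd : ∃ M, ∀ x ∈ closure Ω, |u x| ≤ M) (hv : MeshConvergesUniformly v u)
    (h_pos : ∀ k, 0 < h k) (h_lim : Tendsto h atTop (𝓝 0)) {B : Set (Space d)} (hB : B ⊆ Ω)
    (hBnull : curvature Ω R u (frontier B ∩ Ω) = 0) :
    curvature Ω R u B ≤ liminf (fun k => discreteCurvature R (v (h k)) B) atTop := by
  -- Localization needs a ball around the contact point inside `B`; the rest of `B` carries no
  -- curvature.
  have hsub : B ⊆ interior B ∪ frontier B ∩ Ω := fun x hx => by
    by_cases hxi : x ∈ interior B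
    · exact Or.inl hxi
    · exact Or.inr ⟨⟨subset_closure hx, hxi⟩, hB hx⟩
  refine (curvature_le_of_subset_union hsub hBnull).trans ?_
  simp only [curvature_eq, discreteCurvature_eq]
  refine measure_le_liminf_of_ae_eventually_mem ?_
  filter_upwards [ae_densityMeasure_subdiff_unique hΩ_ne hΩ_bdd hu_bdd] with p huniq hp
  obtain ⟨x, hxB, hpx⟩ := mem_iUnion₂.1 hp
  have hxΩ := hB (interior_subset hxB)
  obtain ⟨r, hr, hrB⟩ := Metric.isOpen_iff.1 isOpen_interior x hxB
  filter_upwards [eventually_discreteSubdiff_near hΩ_open hu_conv hv h_pos h_lim hxΩ hpx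
    (huniq x hxΩ hpx) hr] with k hk
  exact discreteSubdiffImage_mono _ (hrB.trans interior_subset) hk.2

theorem limsup_discreteCurvature_le_of_isCompact (hΩ_open : IsOpen Ω)
    (hu_conv : ConvexOn ℝ (closure Ω) u) (hu_bdd : ∃ M, ∀ x ∈ closure Ω, |u x| ≤ M)
    (hR_int : LocallyIntegrable R) (hv : MeshConvergesUniformly v u)
    (h_pos : ∀ k, 0 < h k) (h_lim : Tendsto h atTop (𝓝 0)) {K : Set (Space d)}
    (hK : IsCompact K) (hKΩ : K ⊆ Ω) :
    limsup (fun k => discreteCurvature R (v (h k)) K) atTop ≤ curvature Ω R u K := by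
  obtain ⟨r, hr⟩ := eventually_discreteSubdiffImage_subset_closedBall hΩ_open hu_bdd hv h_pos
    h_lim hK hKΩ
  simp only [curvature_eq, discreteCurvature_eq]
  exact limsup_measure_le_of_ae_frequently_mem
    (fun k => measurableSet_discreteSubdiffImage _ _)
    (densityMeasure_isCompact_ne_top hR_int (isCompact_closedBall 0 r)) hr
    (Eventually.of_forall fun p =>
      mem_subdiffImage_of_frequently hΩ_open hu_conv hv h_pos h_lim hK hKΩ)

/-- Since `R` vanishes off `∂u(Ω)`, almost every `p` has a contact point in `Ω`; its discrete
contact nodes in `B` accumulate there, placing it in `closure B`. -/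
theorem limsup_discreteCurvature_le_of_finite (hΩ_ne : Ω.Nonempty) (hΩ_open : IsOpen Ω)
    (hΩ_bdd : Bornology.IsBounded Ω) (hu_conv : ConvexOn ℝ (closure Ω) u)
    (hu_bdd : ∃ M, ∀ x ∈ closure Ω, |u x| ≤ M) (hR_int : LocallyIntegrable R)
    (hv : MeshConvergesUniformly v u)
    (h_pos : ∀ k, 0 < h k) (h_lim : Tendsto h atTop (𝓝 0))
    (hR_zero : ∀ p, p ∉ subdiffImage Ω u Ω → R p = 0) (hfin : curvature Ω R u Ω < ⊤)
    (B : Set (Space d)) :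
    limsup (fun k => discreteCurvature R (v (h k)) B) atTop ≤
      curvature Ω R u (closure B ∩ Ω) := by
  have hcompl := densityMeasure_compl_eq_zero hR_int hR_zero
  have huniv : densityMeasure R univ ≠ ⊤ := by
    rw [← union_compl_self (subdiffImage Ω u Ω)]
    refine ((measure_union_le _ _).trans_lt ?_).ne
    rwa [hcompl, add_zero, ← curvature_eq]
  simp only [curvature_eq, discreteCurvature_eq]
  refine limsup_measure_le_of_ae_frequently_mem
    (fun k => measurableSet_discreteSubdiffImage _ _) huniv
    (Eventually.of_forall fun k => subset_univ _) ?_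
  filter_upwards [ae_densityMeasure_subdiff_unique hΩ_ne hΩ_bdd hu_bdd,
    compl_mem_ae_iff.2 hcompl] with p huniq hp hfreq
  rw [compl_compl] at hp
  obtain ⟨x, hxΩ, hpx⟩ := mem_iUnion₂.1 hp
  refine mem_iUnion₂.2 ⟨x, ⟨Metric.mem_closure_iff.2 fun r hr => ?_, hxΩ⟩, hpx⟩
  obtain ⟨k, ⟨y, hyB, -, hpy⟩, hk⟩ := (hfreq.and_eventually
    (eventually_discreteSubdiff_near hΩ_open hu_conv hv h_pos h_lim hxΩ hpx
      (huniq x hxΩ hpx) hr)).exists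
  exact ⟨y, hyB, by rw [dist_comm]; exact hk.1 y hpy⟩

end Curvature

end MeshMA

theorem theorem4p2 {d : ℕ} (Ω : Set (MeshMA.Space d)) (hΩ_ne : Ω.Nonempty) (hΩ_open : IsOpen Ω)
    (hΩ_conv : Convex ℝ Ω) (hΩ_bdd : Bornology.IsBounded Ω)
    (V : Set (Fin d → ℤ)) (hV_basis : ∀ i : Fin d, Pi.single i (1 : ℤ) ∈ V)
    (hV_symm : ∀ e ∈ V, -e ∈ V)
    (u : MeshMA.Space d → ℝ) (hu_conv : ConvexOn ℝ (closure Ω) u)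
    (hu_bdd : ∃ M : ℝ, ∀ x ∈ closure Ω, |u x| ≤ M)
    (R : MeshMA.Space d → ℝ) (hR_int : LocallyIntegrable R) (hR_nonneg : ∀ p, 0 ≤ R p)
    (hR_pos : ∀ p ∈ MeshMA.subdiffImage Ω u Ω, 0 < R p)
    (v : ∀ h : ℝ, MeshMA.MeshFunction Ω V h) (hv : MeshMA.MeshConvergesUniformly v u)
    (h : ℕ → ℝ) (h_pos : ∀ k, 0 < h k) (h_lim : Tendsto h atTop (𝓝 0)) :
    MeshMA.WeaklyConverges Ω (fun k => MeshMA.discreteCurvature R (v (h k)))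
        (MeshMA.curvature Ω R u) ∧
      ((∀ p, p ∉ MeshMA.subdiffImage Ω u Ω → R p = 0) → MeshMA.curvature Ω R u Ω < ⊤ →
        MeshMA.WeaklyConvergesUpToBoundary Ω (fun k => MeshMA.discreteCurvature R (v (h k)))
          (MeshMA.curvature Ω R u)) := by
  constructor
  · intro B _ hBΩ hfr hnull
    -- This makes `closure B` a compact subset of `Ω`, so the compact limsup bound applies.
    have hcl : closure B ⊆ Ω := by
      rw [closure_eq_self_union_frontier]
      exact union_subset hBΩ hfr
    refine tendsto_of_le_liminf_of_limsup_le
      (MeshMA.curvature_le_liminf_discreteCurvature hΩ_ne hΩ_open hΩ_bdd hu_conv hu_bdd hv h_pos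
        h_lim hBΩ (by rwa [inter_eq_left.2 hfr])) ?_
    refine le_trans (limsup_le_limsup (Eventually.of_forall fun k => ?_))
      ((MeshMA.limsup_discreteCurvature_le_of_isCompact hΩ_open hu_conv hu_bdd hR_int hv h_pos
        h_lim (hΩ_bdd.subset hBΩ).isCompact_closure hcl).trans
        (MeshMA.curvature_le_of_subset_union (closure_eq_self_union_frontier B).subset hnull))
    exact lintegral_mono_set (MeshMA.discreteSubdiffImage_mono _ subset_closure)
  · intro hR_zero hfin B _ hBΩ hnull
    refine tendsto_of_le_liminf_of_limsup_le
      (MeshMA.curvature_le_liminf_discreteCurvature hΩ_ne hΩ_open hΩ_bdd hu_conv hu_bdd hv h_pos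
        h_lim hBΩ hnull)
      ((MeshMA.limsup_discreteCurvature_le_of_finite hΩ_ne hΩ_open hΩ_bdd hu_conv hu_bdd hR_int hv
        h_pos h_lim hR_zero hfin B).trans (MeshMA.curvature_le_of_subset_union ?_ hnull))
    rw [closure_eq_self_union_frontier, union_inter_distrib_right]
    exact union_subset_union_left _ inter_subset_left
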